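/- For $u\in L^2(\mathbb{R})$ (complex-valued) the Hilbert transform is $$\mathcal{H}[u](x)=\frac1\pi\,\mathrm{p.v.}\!\int_{\mathbb{R}}\frac{u(y)}{x-y}\,\mathrm{d}y,\qquad \mathrm{p.v.}\!\int_{\mathbb{R}}=\lim_{\varepsilon\downarrow0}\int_{|x-y|>\varepsilon}.$$ For $\phi$ in the Schwartz space $\mathcal{S}(\mathbb{R})$ and $s\in(0,1)$ let $$(-\Delta)^{s}\phi(x)=c_s\,\mathrm{p.v.}\!\int_{\mathbb{R}}\frac{\phi(x)-\phi(y)}{|x-y|^{1+2s}}\,\mathrm{d}y,\qquad c_s=\frac{4^s\,\Gamma(1/2+s)}{\pi^{1/2}\,|\Gamma(-s)|},$$ and for $u\in L^2(\mathbb{R})$ let $(-\Delta)^{1/2}[u]$ be the functional on $\mathcal{S}(\mathbb{R})$ given by $\langle(-\Delta)^{1/2}[u],\phi\rangle=\int_{\mathbb{R}}u\,(-\Delta)^{1/2}\phi\,\mathrm{d}x$. **Theorem.** Let $u\in L^2(\mathbb{R})$ be such that $(-\Delta)^{1/2}[u]$ is a tempered distribution. Then the principal value defining $\mathcal{H}[u](x)$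 exists for almost every $x\in\mathbb{R}$, $\mathcal{H}[u]\in L^2(\mathbb{R})$, and $$\frac{\mathrm{d}}{\mathrm{d}x}\mathcal{H}[u]=(-\Delta)^{1/2}[u]$$ in the sense of (tempered) distributions; that is, $-\int_{\mathbb{R}}\mathcal{H}[u]\,\phi'\,\mathrm{d}x=\langle(-\Delta)^{1/2}[u],\phi\rangle$ for every $\phi\in\mathcal{S}(\mathbb{R})$. -/

import Mathlib

open MeasureTheory Filter Topology SchwartzMap

noncomputable section

/-- The Cauchy principal value at `x` of `∫ f(y) dy` over the real line exists and equals `I`: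
`f` is integrable off every neighbourhood of `x`, and the integrals over `{y : |x - y| > ε}`
converge to `I` as `ε ↓ 0`. -/
def HasPrincipalValue (f : ℝ → ℂ) (x : ℝ) (I : ℂ) : Prop :=
  (∀ ε : ℝ, 0 < ε → IntegrableOn f {y : ℝ | ε < |x - y|} volume) ∧
    Tendsto (fun ε : ℝ => ∫ y in {y : ℝ | ε < |x - y|}, f y) (𝓝[>] 0) (𝓝 I)

/-- The Cauchy principal value at `x` of `∫ f(y) dy` over the real line (only meaningful when
`HasPrincipalValue f x I` holds for some `I`). -/
def principalValue (f : ℝ → ℂ) (x : ℝ) : ℂ :=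
  limUnder (𝓝[>] (0 : ℝ)) (fun ε : ℝ => ∫ y in {y : ℝ | ε < |x - y|}, f y)

/-- If the principal value exists, then `principalValue` is that value. -/
theorem HasPrincipalValue.principalValue_eq {f : ℝ → ℂ} {x : ℝ} {I : ℂ}
    (h : HasPrincipalValue f x I) : principalValue f x = I :=
  h.2.limUnder_eq

/-- The Hilbert transform `H[u](x) = (1/π) p.v. ∫ u(y) / (x - y) dy`. -/
def hilbertTransform (u : ℝ → ℂ) (x : ℝ) : ℂ :=
  (1 / (Real.pi : ℂ)) * principalValue (fun y : ℝ => u y / ((x - y : ℝ) : ℂ)) x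

/-- The constant `c_s = 4^s Γ(1/2 + s) / (π^{1/2} |Γ(-s)|)`. -/
def fracLaplacianConst (s : ℝ) : ℝ :=
  (4 : ℝ) ^ s * Real.Gamma (1 / 2 + s) / (Real.pi ^ (1 / 2 : ℝ) * |Real.Gamma (-s)|)

/-- The fractional Laplacian of a Schwartz function as a singular integral:
`(-Δ)^s φ(x) = c_s p.v. ∫ (φ(x) - φ(y)) / |x - y|^{1 + 2s} dy`, for `0 < s < 1`. -/
def fracLaplacian (s : ℝ) (φ : 𝓢(ℝ, ℂ)) (x : ℝ) : ℂ :=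
  (fracLaplacianConst s : ℂ) *
    principalValue (fun y : ℝ => (φ x - φ y) / ((|x - y| ^ (1 + 2 * s) : ℝ) : ℂ)) x

/-- The sqrt-Laplacian `(-Δ)^{1/2} u` of a function `u ∈ L²(ℝ)`, as a functional on Schwartz
functions: `⟨(-Δ)^{1/2} u, φ⟩ = ∫ u (-Δ)^{1/2} φ dx`. -/
def sqrtLaplacian (u : ℝ → ℂ) (φ : 𝓢(ℝ, ℂ)) : ℂ :=
  ∫ x : ℝ, u x * fracLaplacian (1 / 2) φ x

end

/-!
The proof compares the truncated Hilbert integrals of `u ∈ L²(ℝ)` with the Hilbert transform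
defined on `L²` through the Fourier symbol `-i sgn ξ` (`hilbertL2`).

Let `P_ε` and `Q_ε` be the Poisson and conjugate Poisson kernels of the upper half plane. Since
`𝓕 P_ε (ξ) = exp(-2πε|ξ|)` and `𝓕 Q_ε (ξ) = -i sgn ξ · exp(-2πε|ξ|)`, Plancherel's theorem gives
`Q_ε ∗ u = P_ε ∗ (hilbertL2 u)` (`integral_halfPlaneConjPoisson_mul`), and the right-hand side tends
to `hilbertL2 u` at every Lebesgue point. The difference between `Q_ε` and the truncated kernel
`1_{|t| > ε} / (π t)` is odd and dominated by `P_ε`, so its convolution with `u` tends to `0` at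
every Lebesgue point of `u`. Hence the principal value exists almost everywhere and the pointwise
Hilbert transform is `hilbertL2 u` (`ae_hasPrincipalValue_hilbertL2`); no maximal inequality for the
truncations is needed.

The symbol is purely imaginary, so the Hilbert transform is skew-symmetric for the bilinear pairing
(`integral_hilbertTransform_mul`). For a Schwartz function `φ`, integration by parts off
`[x - ε, x + ε]` identifies the singular integral `(-Δ)^{1/2} φ` with the Hilbert transform of `φ'`
(`fracLaplacian_half_ae_eq`). Together, `-∫ H[u] φ' = ∫ u H[φ'] = ∫ u (-Δ)^{1/2} φ`.
-/

noncomputable section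

open scoped FourierTransform ComplexConjugate InnerProductSpace

/-! ### The Poisson kernels and the truncated Hilbert kernel -/

/-- The Poisson kernel of the upper half plane, `P_ε(t) = ε / (π (ε² + t²))`. -/
def halfPlanePoisson (ε t : ℝ) : ℝ := Real.pi⁻¹ * (ε / (ε ^ 2 + t ^ 2))

/-- The conjugate Poisson kernel of the upper half plane, `Q_ε(t) = t / (π (ε² + t²))`. -/
def halfPlaneConjPoisson (ε t : ℝ) : ℝ := Real.pi⁻¹ * (t / (ε ^ 2 + t ^ 2))

/-- The truncated Hilbert kernel, `1 / (π t)` for `ε < |t|` and `0` otherwise. -/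
def truncHilbertKernel (ε t : ℝ) : ℝ := if ε < |t| then Real.pi⁻¹ * t⁻¹ else 0

lemma measurable_halfPlanePoisson (ε : ℝ) : Measurable (halfPlanePoisson ε) := by
  unfold halfPlanePoisson; fun_prop

lemma measurable_halfPlaneConjPoisson (ε : ℝ) : Measurable (halfPlaneConjPoisson ε) := by
  unfold halfPlaneConjPoisson; fun_prop

lemma measurable_truncHilbertKernel (ε : ℝ) : Measurable (truncHilbertKernel ε) := by
  unfold truncHilbertKernel
  exact Measurable.ite (measurableSet_lt measurable_const (by fun_prop)) (by fun_prop)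
    measurable_const

lemma halfPlanePoisson_nonneg {ε : ℝ} (hε : 0 < ε) (t : ℝ) : 0 ≤ halfPlanePoisson ε t := by
  unfold halfPlanePoisson; positivity

lemma halfPlaneConjPoisson_neg (ε t : ℝ) :
    halfPlaneConjPoisson ε (-t) = -halfPlaneConjPoisson ε t := by
  simp [halfPlaneConjPoisson, neg_div]

lemma truncHilbertKernel_neg (ε t : ℝ) :
    truncHilbertKernel ε (-t) = -truncHilbertKernel ε t := by
  unfold truncHilbertKernel
  rw [abs_neg]
  split_ifs <;> simp [inv_neg]

lemma halfPlanePoisson_eq {ε : ℝ} (hε : 0 < ε) (t : ℝ) :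
    halfPlanePoisson ε t = (Real.pi * ε)⁻¹ * (1 + (t / ε) ^ 2)⁻¹ := by
  have := Real.pi_pos
  unfold halfPlanePoisson
  field_simp

lemma integrable_halfPlanePoisson {ε : ℝ} (hε : 0 < ε) : Integrable (halfPlanePoisson ε) := by
  have h := (integrable_inv_one_add_sq.comp_div hε.ne').const_mul (Real.pi * ε)⁻¹
  exact h.congr (.of_forall fun t => (halfPlanePoisson_eq hε t).symm)

lemma integral_halfPlanePoisson {ε : ℝ} (hε : 0 < ε) : ∫ t, halfPlanePoisson ε t = 1 := by
  simp_rw [halfPlanePoisson_eq hε]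
  rw [integral_const_mul, Measure.integral_comp_div (fun t : ℝ => (1 + t ^ 2)⁻¹) ε,
    integral_univ_inv_one_add_sq, abs_of_pos hε, smul_eq_mul]
  have := Real.pi_pos
  field_simp

lemma memLp_two_of_sq_le_halfPlanePoisson {ε : ℝ} (hε : 0 < ε) {f : ℝ → ℝ} (hf : Measurable f)
    (h : ∀ t, f t ^ 2 ≤ (Real.pi * ε)⁻¹ * halfPlanePoisson ε t) : MemLp f 2 := by
  rw [memLp_two_iff_integrable_sq_norm hf.aestronglyMeasurable]
  refine ((integrable_halfPlanePoisson hε).const_mul (Real.pi * ε)⁻¹).mono'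
    (by fun_prop) (.of_forall fun t => ?_)
  simpa using h t

/-- The identity `P_ε² + Q_ε² = P_ε / (π ε)`, which makes both kernels square integrable. -/
lemma halfPlanePoisson_sq_add_sq {ε : ℝ} (hε : 0 < ε) (t : ℝ) :
    halfPlanePoisson ε t ^ 2 + halfPlaneConjPoisson ε t ^ 2 =
      (Real.pi * ε)⁻¹ * halfPlanePoisson ε t := by
  have := Real.pi_pos
  unfold halfPlanePoisson halfPlaneConjPoisson
  field_simp

lemma memLp_halfPlanePoisson {ε : ℝ} (hε : 0 < ε) : MemLp (halfPlanePoisson ε) 2 :=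
  memLp_two_of_sq_le_halfPlanePoisson hε (measurable_halfPlanePoisson ε) fun t => by
    have := halfPlanePoisson_sq_add_sq hε t
    nlinarith [sq_nonneg (halfPlaneConjPoisson ε t)]

lemma memLp_halfPlaneConjPoisson {ε : ℝ} (hε : 0 < ε) : MemLp (halfPlaneConjPoisson ε) 2 :=
  memLp_two_of_sq_le_halfPlanePoisson hε (measurable_halfPlaneConjPoisson ε) fun t => by
    have := halfPlanePoisson_sq_add_sq hε t
    nlinarith [sq_nonneg (halfPlanePoisson ε t)]

/-- Regularizing `1 / (π t)` by `Q_ε` and truncating it at `ε` differ by an integrable kernel,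
dominated by the Poisson kernel: by `|t| / (π (ε² + t²))` for `|t| ≤ ε`, and by
`ε² / (π |t| (ε² + t²))` for `|t| > ε`. -/
lemma abs_halfPlaneConjPoisson_sub_truncHilbertKernel_le {ε : ℝ} (hε : 0 < ε) (t : ℝ) :
    |halfPlaneConjPoisson ε t - truncHilbertKernel ε t| ≤ halfPlanePoisson ε t := by
  have hpi := Real.pi_pos
  unfold halfPlaneConjPoisson truncHilbertKernel halfPlanePoisson
  split_ifs with h
  · have ht : t ≠ 0 := by rintro rfl; simp at h; linarith
    have hta : 0 < |t| := abs_pos.2 ht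
    have e : Real.pi⁻¹ * (t / (ε ^ 2 + t ^ 2)) - Real.pi⁻¹ * t⁻¹ =
        -(Real.pi⁻¹ * (ε ^ 2 / (t * (ε ^ 2 + t ^ 2)))) := by
      field_simp; ring
    rw [e, abs_neg, abs_mul, abs_div, abs_mul, abs_of_pos (inv_pos.2 hpi),
      abs_of_pos (by positivity : 0 < ε ^ 2), abs_of_pos (by positivity : 0 < ε ^ 2 + t ^ 2)]
    refine mul_le_mul_of_nonneg_left ?_ (inv_pos.2 hpi).le
    rw [div_le_div_iff₀ (by positivity) (by positivity)]
    have : ε * ε ≤ ε * |t| := by gcongr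
    have h2 : 0 < ε ^ 2 + t ^ 2 := by positivity
    nlinarith
  · rw [sub_zero, abs_mul, abs_div, abs_of_pos (inv_pos.2 hpi),
      abs_of_pos (by positivity : 0 < ε ^ 2 + t ^ 2)]
    gcongr
    exact not_lt.1 h

lemma integral_halfPlaneConjPoisson_sub_truncHilbertKernel (ε : ℝ) :
    ∫ t, (halfPlaneConjPoisson ε t - truncHilbertKernel ε t) = 0 := by
  have h := integral_neg_eq_self
    (fun t => halfPlaneConjPoisson ε t - truncHilbertKernel ε t) (volume : Measure ℝ)
  simp only [halfPlaneConjPoisson_neg, truncHilbertKernel_neg] at h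
  have e : (fun t => -halfPlaneConjPoisson ε t - -truncHilbertKernel ε t) =
      fun t => -(halfPlaneConjPoisson ε t - truncHilbertKernel ε t) := by
    ext t; ring
  rw [e, integral_neg] at h
  linarith

lemma memLp_truncHilbertKernel {ε : ℝ} (hε : 0 < ε) : MemLp (truncHilbertKernel ε) 2 := by
  have hD : MemLp (fun t => halfPlaneConjPoisson ε t - truncHilbertKernel ε t) 2 :=
    (memLp_halfPlanePoisson hε).mono
      ((measurable_halfPlaneConjPoisson ε).sub
        (measurable_truncHilbertKernel ε)).aestronglyMeasurable
      (.of_forall fun t => by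
        rw [Real.norm_eq_abs, Real.norm_of_nonneg (halfPlanePoisson_nonneg hε t)]
        exact abs_halfPlaneConjPoisson_sub_truncHilbertKernel_le hε t)
  convert (memLp_halfPlaneConjPoisson hε).sub hD using 1
  ext t
  simp

/-! ### Approximate identities at Lebesgue points -/

/-- `x` is a Lebesgue point of `w`: the mean oscillation of `w` about `w x` over the interval of
radius `r` centred at `x` tends to `0` with `r`. -/
def IsLebesguePoint (w : ℝ → ℂ) (x : ℝ) : Prop :=
  Tendsto (fun r : ℝ => (∫⁻ y in Metric.closedBall x r, ‖w y - w x‖ₑ) / ENNReal.ofReal (2 * r))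
    (𝓝[>] 0) (𝓝 0)

lemma MeasureTheory.LocallyIntegrable.ae_isLebesguePoint {w : ℝ → ℂ} (hw : LocallyIntegrable w) :
    ∀ᵐ x, IsLebesguePoint w x := by
  filter_upwards [(Besicovitch.vitaliFamily
    (volume : Measure ℝ)).ae_tendsto_lintegral_enorm_sub_div hw] with x hx
  simpa [IsLebesguePoint, Function.comp_def] using hx.comp (Besicovitch.tendsto_filterAt volume x)

/-- For a square integrable function, the mean oscillation about a Lebesgue point is bounded over
all radii: near `0` by definition, and for large radii by square integrability. -/
lemma IsLebesguePoint.exists_bound {w : ℝ → ℂ} (hw : MemLp w 2) {x : ℝ}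
    (hx : IsLebesguePoint w x) :
    ∃ M : ENNReal, M ≠ ⊤ ∧ ∀ r : ℝ, 0 < r →
      (∫⁻ y in Metric.closedBall x r, ‖w y - w x‖ₑ) / ENNReal.ofReal (2 * r) ≤ M := by
  have h1 : ∀ᶠ r in 𝓝[>] (0 : ℝ),
      (∫⁻ y in Metric.closedBall x r, ‖w y - w x‖ₑ) / ENNReal.ofReal (2 * r) ≤ 1 :=
    hx.eventually (ge_mem_nhds (by simp))
  obtain ⟨r₀, hr₀, h1⟩ := mem_nhdsGT_iff_exists_Ioo_subset.1 h1
  have hr₀ : 0 < r₀ := hr₀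
  have hL : ∫⁻ y, ‖w y‖ₑ ^ 2 ≠ ⊤ := by
    have := hw.2
    rw [eLpNorm_lt_top_iff_lintegral_rpow_enorm_lt_top (by simp) (by simp)] at this
    simpa using this.ne
  refine ⟨1 + ((1 + ‖w x‖ₑ) + (∫⁻ y, ‖w y‖ₑ ^ 2) / ENNReal.ofReal (2 * r₀)), ?_, ?_⟩
  · refine ENNReal.add_ne_top.2 ⟨by simp, ENNReal.add_ne_top.2 ⟨by simp, ?_⟩⟩
    exact ENNReal.div_ne_top hL (by simpa using hr₀)
  · intro r hr
    rcases lt_or_ge r r₀ with h | h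
    · exact (h1 ⟨hr, h⟩ : _ ≤ (1 : ENNReal)).trans le_self_add
    · refine le_trans ?_ le_add_self
      -- `|w y - w x| ≤ (1 + |w x|) + |w y|²`, integrated over the ball
      have key : ∫⁻ y in Metric.closedBall x r, ‖w y - w x‖ₑ ≤
          (1 + ‖w x‖ₑ) * ENNReal.ofReal (2 * r) + ∫⁻ y, ‖w y‖ₑ ^ 2 := by
        calc ∫⁻ y in Metric.closedBall x r, ‖w y - w x‖ₑ
            ≤ ∫⁻ y in Metric.closedBall x r, ((1 + ‖w x‖ₑ) + ‖w y‖ₑ ^ 2) := by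
              refine lintegral_mono fun y => ?_
              have a : ‖w y‖ₑ ≤ 1 + ‖w y‖ₑ ^ 2 := by
                rcases le_total ‖w y‖ₑ 1 with h | h
                · exact h.trans le_self_add
                · exact (le_self_pow₀ h two_ne_zero).trans le_add_self
              calc ‖w y - w x‖ₑ ≤ ‖w y‖ₑ + ‖w x‖ₑ := enorm_sub_le
                _ ≤ (1 + ‖w y‖ₑ ^ 2) + ‖w x‖ₑ := by gcongr
                _ = _ := by ring
          _ = (1 + ‖w x‖ₑ) * ENNReal.ofReal (2 * r) +
                ∫⁻ y in Metric.closedBall x r, ‖w y‖ₑ ^ 2 := by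
              rw [lintegral_add_left measurable_const]; simp
          _ ≤ _ := by gcongr; exact Measure.restrict_le_self
      have hr2 : ENNReal.ofReal (2 * r) ≠ 0 := by simpa using hr
      calc _ ≤ ((1 + ‖w x‖ₑ) * ENNReal.ofReal (2 * r) + ∫⁻ y, ‖w y‖ₑ ^ 2) /
            ENNReal.ofReal (2 * r) := by gcongr
        _ = (1 + ‖w x‖ₑ) + (∫⁻ y, ‖w y‖ₑ ^ 2) / ENNReal.ofReal (2 * r) := by
            rw [ENNReal.add_div, ENNReal.mul_div_cancel_right hr2 ENNReal.ofReal_ne_top]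
        _ ≤ _ := by gcongr


/-- Dyadic layering of the Poisson kernel: `P_ε(x - y) ≤ 4^{1-n} / ε` for the least `n` with
`|x - y| ≤ 2ⁿ ε`. -/
lemma ofReal_halfPlanePoisson_le_tsum {ε : ℝ} (hε : 0 < ε) (x y : ℝ) :
    ENNReal.ofReal (halfPlanePoisson ε (x - y)) ≤
      ∑' n : ℕ, (Metric.closedBall x (2 ^ n * ε)).indicator
        (fun _ => ENNReal.ofReal (4 / 4 ^ n / ε)) y := by
  have hex : ∃ n : ℕ, |x - y| ≤ 2 ^ n * ε := by
    obtain ⟨n, hn⟩ := pow_unbounded_of_one_lt (|x - y| / ε) (one_lt_two (α := ℝ))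
    exact ⟨n, ((div_lt_iff₀ hε).1 hn).le⟩
  classical
  have hn := Nat.find_spec hex
  have hmin := fun m => Nat.find_min hex (m := m)
  generalize Nat.find hex = n at hn hmin
  refine le_trans ?_ (ENNReal.le_tsum n)
  rw [Set.indicator_of_mem (by simpa [Real.dist_eq, abs_sub_comm] using hn)]
  apply ENNReal.ofReal_le_ofReal
  have hpi : Real.pi⁻¹ ≤ 1 := inv_le_one_of_one_le₀ (by linarith [Real.pi_gt_three])
  have h1 : halfPlanePoisson ε (x - y) ≤ ε / (ε ^ 2 + (x - y) ^ 2) :=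
    mul_le_of_le_one_left (by positivity) hpi
  refine h1.trans ?_
  rw [div_le_div_iff₀ (by positivity) hε]
  rcases n with _ | m
  · nlinarith [sq_nonneg (x - y), sq_nonneg ε]
  · have h2 : 2 ^ m * ε < |x - y| := not_le.1 (hmin m (Nat.lt_succ_self m))
    have h3 : (2 ^ m * ε) ^ 2 ≤ (x - y) ^ 2 := by
      rw [← sq_abs (x - y)]; gcongr
    have h4 : (4 : ℝ) / 4 ^ (m + 1) * 4 ^ m = 1 := by rw [pow_succ]; field_simp
    have h5 : (2 ^ m * ε) ^ 2 = 4 ^ m * ε ^ 2 := by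
      rw [mul_pow, ← pow_mul, mul_comm m, pow_mul]; norm_num
    calc ε * ε = 4 / 4 ^ (m + 1) * (4 ^ m * ε ^ 2) := by rw [← mul_assoc, h4]; ring
      _ ≤ 4 / 4 ^ (m + 1) * (ε ^ 2 + (x - y) ^ 2) := by
        gcongr; rw [← h5]; nlinarith [sq_nonneg ε]

/-- Poisson averages of the oscillation about a Lebesgue point tend to `0`: the dyadic layering
turns them into `∑ 2^{3-n} A(2ⁿ ε)` with `A(r)` the mean oscillation at radius `r`, and dominated
convergence applies to this series. -/
lemma IsLebesguePoint.tendsto_lintegral_halfPlanePoisson {w : ℝ → ℂ} (hw : MemLp w 2) {x : ℝ}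
    (hx : IsLebesguePoint w x) :
    Tendsto (fun ε : ℝ => ∫⁻ y, ENNReal.ofReal (halfPlanePoisson ε (x - y)) * ‖w y - w x‖ₑ)
      (𝓝[>] 0) (𝓝 0) := by
  obtain ⟨M, hM, hbound⟩ := hx.exists_bound hw
  set A : ℝ → ENNReal := fun r =>
    (∫⁻ y in Metric.closedBall x r, ‖w y - w x‖ₑ) / ENNReal.ofReal (2 * r) with hA
  have hgeom : ∑' n : ℕ, ENNReal.ofReal (8 / 2 ^ n) ≠ ⊤ := by
    have hs : Summable fun n : ℕ => (8 : ℝ) / 2 ^ n := by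
      simpa [div_eq_mul_inv] using
        (summable_geometric_of_lt_one (r := (2 : ℝ)⁻¹) (by norm_num) (by norm_num)).mul_left 8
    rw [← ENNReal.ofReal_tsum_of_nonneg (fun n => by positivity) hs]
    exact ENNReal.ofReal_ne_top
  have hsum : Tendsto (fun ε : ℝ => ∑' n : ℕ, ENNReal.ofReal (8 / 2 ^ n) * A (2 ^ n * ε))
      (𝓝[>] 0) (𝓝 0) := by
    have := tendsto_lintegral_filter_of_dominated_convergence (μ := Measure.count) (l := 𝓝[>] 0)
      (F := fun (ε : ℝ) (n : ℕ) => ENNReal.ofReal (8 / 2 ^ n) * A (2 ^ n * ε)) (f := fun _ => 0)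
      (fun n => ENNReal.ofReal (8 / 2 ^ n) * M) (.of_forall fun _ => Measurable.of_discrete)
      ?_ ?_ ?_
    · simpa [lintegral_count] using this
    · filter_upwards [self_mem_nhdsWithin] with ε (hε : 0 < ε)
      exact .of_forall fun n => mul_le_mul_right (hbound _ (by positivity)) _
    · rw [lintegral_count, ENNReal.tsum_mul_right]
      exact ENNReal.mul_ne_top hgeom hM
    · refine .of_forall fun n => ?_
      have ht : Tendsto (fun ε : ℝ => 2 ^ n * ε) (𝓝[>] 0) (𝓝[>] 0) := by
        refine tendsto_nhdsWithin_iff.2 ⟨?_, ?_⟩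
        · exact (Continuous.tendsto' (by fun_prop) 0 0 (by simp)).mono_left nhdsWithin_le_nhds
        · filter_upwards [self_mem_nhdsWithin] with ε (hε : 0 < ε)
          exact Set.mem_Ioi.2 (by positivity)
      have hA0 : Tendsto (fun ε => A (2 ^ n * ε)) (𝓝[>] 0) (𝓝 0) := Tendsto.comp hx ht
      simpa only [mul_zero] using ENNReal.Tendsto.const_mul hA0 (Or.inr ENNReal.ofReal_ne_top)
  refine tendsto_of_tendsto_of_tendsto_of_le_of_le' tendsto_const_nhds hsum
    (.of_forall fun _ => zero_le) ?_
  filter_upwards [self_mem_nhdsWithin] with ε (hε : 0 < ε)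
  have hmeas : AEMeasurable (fun y => ‖w y - w x‖ₑ) :=
    (hw.1.sub aestronglyMeasurable_const).enorm
  calc ∫⁻ y, ENNReal.ofReal (halfPlanePoisson ε (x - y)) * ‖w y - w x‖ₑ
      ≤ ∫⁻ y, ∑' n : ℕ, (Metric.closedBall x (2 ^ n * ε)).indicator
          (fun y => ENNReal.ofReal (4 / 4 ^ n / ε) * ‖w y - w x‖ₑ) y := by
        refine lintegral_mono fun y => ?_
        refine (mul_le_mul_left (ofReal_halfPlanePoisson_le_tsum hε x y) _).trans ?_
        rw [← ENNReal.tsum_mul_right]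
        refine ENNReal.tsum_le_tsum fun n => ?_
        by_cases hy : y ∈ Metric.closedBall x (2 ^ n * ε) <;> simp [hy]
    _ = ∑' n : ℕ, ENNReal.ofReal (4 / 4 ^ n / ε) *
          ∫⁻ y in Metric.closedBall x (2 ^ n * ε), ‖w y - w x‖ₑ := by
        rw [lintegral_tsum fun n =>
          (hmeas.const_mul _).indicator Metric.isClosed_closedBall.measurableSet]
        refine tsum_congr fun n => ?_
        rw [lintegral_indicator Metric.isClosed_closedBall.measurableSet,
          lintegral_const_mul' _ _ ENNReal.ofReal_ne_top]
    _ = ∑' n : ℕ, ENNReal.ofReal (8 / 2 ^ n) * A (2 ^ n * ε) := by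
        refine tsum_congr fun n => ?_
        have h4 : (4 : ℝ) / 4 ^ n / ε = 8 / 2 ^ n * (2 * (2 ^ n * ε))⁻¹ := by
          have : (4 : ℝ) ^ n = 2 ^ n * 2 ^ n := by rw [← mul_pow]; norm_num
          rw [this]; field_simp; norm_num
        rw [h4, ENNReal.ofReal_mul (by positivity), ENNReal.ofReal_inv_of_pos (by positivity),
          mul_assoc, mul_comm (ENNReal.ofReal _)⁻¹, ← div_eq_mul_inv]

/-- Integration against any kernels dominated by the Poisson kernels kills the oscillation about a
Lebesgue point. -/
lemma IsLebesguePoint.tendsto_integral_kernel_mul_sub {w : ℝ → ℂ} (hw : MemLp w 2) {x : ℝ}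
    (hx : IsLebesguePoint w x) {K : ℝ → ℝ → ℝ}
    (hK : ∀ ε, 0 < ε → ∀ t, |K ε t| ≤ halfPlanePoisson ε t) :
    Tendsto (fun ε : ℝ => ∫ y, (K ε (x - y) : ℂ) * (w y - w x)) (𝓝[>] 0) (𝓝 0) := by
  rw [tendsto_zero_iff_enorm_tendsto_zero]
  refine tendsto_of_tendsto_of_tendsto_of_le_of_le' tendsto_const_nhds
    (hx.tendsto_lintegral_halfPlanePoisson hw) (.of_forall fun _ => zero_le) ?_
  filter_upwards [self_mem_nhdsWithin] with ε (hε : 0 < ε)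
  refine (enorm_integral_le_lintegral_enorm _).trans (lintegral_mono fun y => ?_)
  rw [enorm_mul]
  gcongr
  rw [← ofReal_norm, Complex.norm_real]
  exact ENNReal.ofReal_le_ofReal (hK ε hε _)

/-- Convolution with kernels of mass `c` dominated by the Poisson kernels converges to `c • w` at
Lebesgue points. -/
lemma IsLebesguePoint.tendsto_integral_kernel_mul {w : ℝ → ℂ} (hw : MemLp w 2) {x : ℝ}
    (hx : IsLebesguePoint w x) {K : ℝ → ℝ → ℝ} {c : ℝ} (hKm : ∀ ε, Measurable (K ε))
    (hK : ∀ ε, 0 < ε → ∀ t, |K ε t| ≤ halfPlanePoisson ε t)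
    (hKc : ∀ ε, 0 < ε → ∫ t, K ε t = c) :
    Tendsto (fun ε : ℝ => ∫ y, (K ε (x - y) : ℂ) * w y) (𝓝[>] 0) (𝓝 (c * w x)) := by
  have h := (hx.tendsto_integral_kernel_mul_sub hw hK).add_const ((c : ℂ) * w x)
  rw [zero_add] at h
  refine h.congr' ?_
  filter_upwards [self_mem_nhdsWithin] with ε (hε : 0 < ε)
  have hI : Integrable (K ε) := (integrable_halfPlanePoisson hε).mono'
    (hKm ε).aestronglyMeasurable (.of_forall fun t => hK ε hε t)
  have hI2 : MemLp (fun y => (K ε (x - y) : ℂ)) 2 :=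
    (((memLp_halfPlanePoisson hε).mono (hKm ε).aestronglyMeasurable (.of_forall fun t => by
      rw [Real.norm_eq_abs, Real.norm_of_nonneg (halfPlanePoisson_nonneg hε t)]
      exact hK ε hε t)).comp_measurePreserving (Measure.measurePreserving_sub_left volume x)).ofReal
  have i1 : Integrable fun y => (K ε (x - y) : ℂ) * w y := hI2.integrable_mul hw
  have i2 : Integrable fun y => (K ε (x - y) : ℂ) * w x :=
    (hI.comp_sub_left x).ofReal.mul_const _
  have i3 : ∫ y, (K ε (x - y) : ℂ) * w x = c * w x := by
    rw [integral_mul_const, integral_sub_left_eq_self (fun t => (K ε t : ℂ)),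
      integral_complex_ofReal, hKc ε hε]
  simp_rw [mul_sub]
  rw [integral_sub i1 i2, i3, sub_add_cancel]

/-! ### The Fourier multiplier of the Hilbert transform -/

/-- On `L¹ ∩ L²`, the inverse Fourier transform of `L²` is given by the Fourier integral. -/
lemma fourierInv_toLp_eq {f : ℝ → ℂ} (hf : Integrable f) (hf2 : MemLp f 2)
    (hF : MemLp (𝓕⁻ f) 2) : 𝓕⁻ (hf2.toLp f) = hF.toLp (𝓕⁻ f) := by
  -- An `L²` function is determined by its tempered distribution, so it suffices to pair with
  -- Schwartz functions, where Fubini moves the Fourier integral across.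
  have hker := LinearMap.ker_eq_bot.1
    (Lp.ker_toTemperedDistributionCLM_eq_bot (F := ℂ) (μ := (volume : Measure ℝ)) (p := 2))
  apply hker
  change Lp.toTemperedDistribution (𝓕⁻ (hf2.toLp f)) = Lp.toTemperedDistribution (hF.toLp (𝓕⁻ f))
  rw [← Lp.fourierInv_toTemperedDistribution_eq]
  ext g
  rw [TemperedDistribution.fourierInv_apply, Lp.toTemperedDistribution_apply,
    Lp.toTemperedDistribution_apply]
  have h1 : ∫ x, (𝓕⁻ g) x • (hf2.toLp f) x = ∫ x, (𝓕⁻ g) x • f x := by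
    refine integral_congr_ae ?_
    filter_upwards [hf2.coeFn_toLp] with x hx
    rw [hx]
  have h2 : ∫ x, g x • (hF.toLp (𝓕⁻ f)) x = ∫ x, g x • 𝓕⁻ f x := by
    refine integral_congr_ae ?_
    filter_upwards [hF.coeFn_toLp] with x hx
    rw [hx]
  rw [h1, h2, SchwartzMap.fourierInv_coe]
  have hneg : Integrable fun x => f (-x) := hf.comp_neg
  have h3 := VectorFourier.integral_fourierIntegral_smul_eq_flip (L := innerₗ ℝ)
    (μ := volume) (ν := volume) Real.continuous_fourierChar continuous_inner g.integrable hneg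
  rw [flip_innerₗ] at h3
  change ∫ ξ, 𝓕 (⇑g) ξ • f (-ξ) = ∫ x, g x • 𝓕 (fun x => f (-x)) x at h3
  rw [← Real.fourierInv_eq_fourier_comp_neg] at h3
  rw [← h3, ← integral_neg_eq_self]
  simp_rw [Real.fourierInv_eq_fourier_neg, neg_neg]

/-- The Fourier symbol `-i sgn ξ` of the Hilbert transform (with the value `i` at `ξ = 0`). -/
def hilbertSymbol (ξ : ℝ) : ℂ := if 0 < ξ then -Complex.I else Complex.I

lemma measurable_hilbertSymbol : Measurable hilbertSymbol :=
  Measurable.ite measurableSet_Ioi measurable_const measurable_const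

lemma norm_hilbertSymbol (ξ : ℝ) : ‖hilbertSymbol ξ‖ = 1 := by
  unfold hilbertSymbol; split_ifs <;> simp

lemma conj_hilbertSymbol (ξ : ℝ) : conj (hilbertSymbol ξ) = -hilbertSymbol ξ := by
  unfold hilbertSymbol; split_ifs <;> simp

lemma MeasureTheory.MemLp.hilbertSymbol_mul {f : ℝ → ℂ} (hf : MemLp f 2) :
    MemLp (fun ξ => hilbertSymbol ξ * f ξ) 2 :=
  hf.mono (measurable_hilbertSymbol.aestronglyMeasurable.mul hf.1)
    (.of_forall fun ξ => by rw [norm_mul, norm_hilbertSymbol, one_mul])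

/-- The Hilbert transform on `L²(ℝ)` as a Fourier multiplier. -/
def hilbertL2 (w : Lp ℂ 2 (volume : Measure ℝ)) : Lp ℂ 2 (volume : Measure ℝ) :=
  𝓕⁻ ((Lp.memLp (𝓕 w)).hilbertSymbol_mul.toLp _)

lemma inner_fourierInv_left (a w : Lp ℂ 2 (volume : Measure ℝ)) : ⟪𝓕⁻ a, w⟫_ℂ = ⟪a, 𝓕 w⟫_ℂ := by
  rw [← Lp.inner_fourier_eq (𝓕⁻ a) w, FourierTransform.fourier_fourierInv_eq]

lemma inner_fourierInv_right (a w : Lp ℂ 2 (volume : Measure ℝ)) : ⟪w, 𝓕⁻ a⟫_ℂ = ⟪𝓕 w, a⟫_ℂ := by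
  rw [← Lp.inner_fourier_eq w (𝓕⁻ a), FourierTransform.fourier_fourierInv_eq]

/-- Multiplication by the purely imaginary Hilbert symbol is skew-adjoint. -/
lemma inner_hilbertSymbol_mul {f g : ℝ → ℂ} (hf : MemLp f 2) (hg : MemLp g 2) :
    ⟪hf.hilbertSymbol_mul.toLp, hg.toLp g⟫_ℂ = -⟪hf.toLp f, hg.hilbertSymbol_mul.toLp⟫_ℂ := by
  rw [L2.inner_def, L2.inner_def, ← integral_neg]
  refine integral_congr_ae ?_
  filter_upwards [hf.coeFn_toLp, hg.coeFn_toLp, hf.hilbertSymbol_mul.coeFn_toLp,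
    hg.hilbertSymbol_mul.coeFn_toLp] with ξ h1 h2 h3 h4
  rw [h1, h2, h3, h4, RCLike.inner_apply, RCLike.inner_apply, map_mul, conj_hilbertSymbol]
  ring

/-- The Hilbert transform on `L²` is skew-adjoint, by Plancherel. -/
lemma inner_hilbertL2_left (w v : Lp ℂ 2 (volume : Measure ℝ)) :
    ⟪hilbertL2 w, v⟫_ℂ = -⟪w, hilbertL2 v⟫_ℂ := by
  unfold hilbertL2
  rw [inner_fourierInv_left, inner_fourierInv_right]
  have h := inner_hilbertSymbol_mul (Lp.memLp (𝓕 w)) (Lp.memLp (𝓕 v))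
  rwa [Lp.toLp_coeFn, Lp.toLp_coeFn] at h

/-- A function that is exponential on each half-line, decaying at both ends, is integrable with
an explicit integral. -/
lemma integrable_and_integral_of_exp_halves {a b p q : ℂ} (ha : a.re < 0) (hb : 0 < b.re)
    {f : ℝ → ℂ} (hpos : ∀ ξ, 0 < ξ → f ξ = p * Complex.exp (a * ξ))
    (hneg : ∀ ξ, ξ ≤ 0 → f ξ = q * Complex.exp (b * ξ)) :
    Integrable f ∧ ∫ ξ, f ξ = -p / a + q / b := by
  have i1 : IntegrableOn f (Set.Ioi 0) :=
    IntegrableOn.congr_fun ((integrableOn_exp_mul_complex_Ioi ha 0).const_mul p)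
      (fun ξ hξ => (hpos ξ hξ).symm) measurableSet_Ioi
  have i2 : IntegrableOn f (Set.Iic 0) :=
    IntegrableOn.congr_fun ((integrableOn_exp_mul_complex_Iic hb 0).const_mul q)
      (fun ξ hξ => (hneg ξ hξ).symm) measurableSet_Iic
  have i3 : Integrable f := by
    have := i2.union i1
    rwa [Set.Iic_union_Ioi, integrableOn_univ] at this
  refine ⟨i3, ?_⟩
  rw [← intervalIntegral.integral_Iic_add_Ioi i2 i1,
    setIntegral_congr_fun measurableSet_Iic (fun ξ hξ => hneg ξ hξ),
    setIntegral_congr_fun measurableSet_Ioi (fun ξ hξ => hpos ξ hξ),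
    integral_const_mul, integral_const_mul, integral_exp_mul_complex_Ioi ha,
    integral_exp_mul_complex_Iic hb]
  simp
  ring

/-- The Fourier transform of the Poisson kernel centred at `x`:
`ξ ↦ exp(-2πixξ - 2πε|ξ|)`. -/
def poissonSymbol (ε x ξ : ℝ) : ℂ :=
  Complex.exp (2 * Real.pi * (-(x * Complex.I) * ξ - ε * (|ξ| : ℝ)))

lemma poissonSymbol_of_pos (ε x : ℝ) {ξ : ℝ} (hξ : 0 < ξ) :
    poissonSymbol ε x ξ = Complex.exp (2 * Real.pi * (-(x * Complex.I) - ε) * ξ) := by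
  rw [poissonSymbol, abs_of_pos hξ]; ring_nf

lemma poissonSymbol_of_nonpos (ε x : ℝ) {ξ : ℝ} (hξ : ξ ≤ 0) :
    poissonSymbol ε x ξ = Complex.exp (2 * Real.pi * (-(x * Complex.I) + ε) * ξ) := by
  rw [poissonSymbol, abs_of_nonpos hξ]; push_cast; ring_nf

lemma norm_poissonSymbol_le {ε : ℝ} (hε : 0 < ε) (x ξ : ℝ) : ‖poissonSymbol ε x ξ‖ ≤ 1 := by
  have h : (2 * Real.pi * (-(x * Complex.I) * ξ - ε * (|ξ| : ℝ)) : ℂ).re =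
      -(2 * Real.pi * (ε * |ξ|)) := by
    simp
  rw [poissonSymbol, Complex.norm_exp, h, Real.exp_le_one_iff, neg_nonpos]
  have := Real.pi_pos
  positivity

lemma integrable_poissonSymbol {ε : ℝ} (hε : 0 < ε) (x : ℝ) :
    Integrable (poissonSymbol ε x) := by
  have hp := Real.pi_pos
  refine (integrable_and_integral_of_exp_halves
    (a := 2 * Real.pi * (-(x * Complex.I) - ε)) (b := 2 * Real.pi * (-(x * Complex.I) + ε))
    (p := 1) (q := 1) ?_ ?_ (fun ξ hξ => ?_) (fun ξ hξ => ?_)).1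
  · simp; positivity
  · simp; positivity
  · rw [poissonSymbol_of_pos _ _ hξ, one_mul]
  · rw [poissonSymbol_of_nonpos _ _ hξ, one_mul]

lemma memLp_poissonSymbol {ε : ℝ} (hε : 0 < ε) (x : ℝ) : MemLp (poissonSymbol ε x) 2 := by
  have hi := integrable_poissonSymbol hε x
  rw [memLp_two_iff_integrable_sq_norm hi.1]
  refine hi.norm.mono' (hi.1.norm.pow 2) (.of_forall fun ξ => ?_)
  rw [Real.norm_of_nonneg (by positivity)]
  nlinarith [norm_poissonSymbol_le hε x ξ, norm_nonneg (poissonSymbol ε x ξ)]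

/-- The inverse Fourier transform of the Poisson symbol multiplied by `p` on the positive and by
`q` on the negative half-line; the cases `p = q = 1` and `p = -i`, `q = i` are the Poisson and
conjugate Poisson kernels. -/
lemma fourierInv_of_eq_mul_poissonSymbol {ε : ℝ} (hε : 0 < ε) (x y : ℝ) (p q : ℂ) {f : ℝ → ℂ}
    (hpos : ∀ ξ, 0 < ξ → f ξ = p * poissonSymbol ε x ξ)
    (hneg : ∀ ξ, ξ ≤ 0 → f ξ = q * poissonSymbol ε x ξ) :
    𝓕⁻ f y = (p * (ε - (x - y) * Complex.I) + q * (ε + (x - y) * Complex.I)) /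
      (2 * Real.pi * (ε ^ 2 + (x - y) ^ 2)) := by
  have hp := Real.pi_pos
  rw [Real.fourierInv_eq']
  rw [(integrable_and_integral_of_exp_halves
    (a := 2 * Real.pi * (-((x - y) * Complex.I) - ε))
    (b := 2 * Real.pi * (-((x - y) * Complex.I) + ε)) (p := p) (q := q)
    ?_ ?_ (fun ξ hξ => ?_) (fun ξ hξ => ?_)).2]
  · have e1 : (ε + (x - y) * Complex.I : ℂ) ≠ 0 := fun h => by
      have := congrArg Complex.re h
      simp at this; exact hε.ne' this
    have e2 : (ε - (x - y) * Complex.I : ℂ) ≠ 0 := fun h => by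
      have := congrArg Complex.re h
      simp at this; exact hε.ne' this
    have hpc : (Real.pi : ℂ) ≠ 0 := by exact_mod_cast hp.ne'
    rw [show (2 * Real.pi * (-((x - y) * Complex.I) - ε) : ℂ) =
        -(2 * Real.pi * (ε + (x - y) * Complex.I)) by ring,
      show (2 * Real.pi * (-((x - y) * Complex.I) + ε) : ℂ) =
        2 * Real.pi * (ε - (x - y) * Complex.I) by ring, neg_div_neg_eq]
    have e3 : (ε ^ 2 + (x - y) ^ 2 : ℂ) =
        (ε + (x - y) * Complex.I) * (ε - (x - y) * Complex.I) := by
      linear_combination (x - y : ℂ) ^ 2 * Complex.I_sq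
    rw [e3]
    field_simp
  · simp; positivity
  · simp; positivity
  · rw [hpos ξ hξ, poissonSymbol_of_pos _ _ hξ, smul_eq_mul, mul_left_comm, ← Complex.exp_add]
    congr 2
    simp
    ring
  · rw [hneg ξ hξ, poissonSymbol_of_nonpos _ _ hξ, smul_eq_mul, mul_left_comm, ← Complex.exp_add]
    congr 2
    simp
    ring

lemma fourierInv_poissonSymbol {ε : ℝ} (hε : 0 < ε) (x : ℝ) :
    𝓕⁻ (poissonSymbol ε x) = fun y => (halfPlanePoisson ε (x - y) : ℂ) := by
  ext y
  rw [fourierInv_of_eq_mul_poissonSymbol hε x y 1 1 (fun ξ _ => (one_mul _).symm)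
    (fun ξ _ => (one_mul _).symm)]
  rw [halfPlanePoisson]
  push_cast
  rw [show 1 * (ε - (x - y) * Complex.I) + 1 * (ε + (x - y) * Complex.I) = 2 * (ε : ℂ) by ring,
    mul_assoc 2, mul_div_mul_left _ _ two_ne_zero, inv_mul_eq_div, div_div, mul_comm (Real.pi : ℂ)]

lemma fourierInv_hilbertSymbol_mul_poissonSymbol {ε : ℝ} (hε : 0 < ε) (x : ℝ) :
    𝓕⁻ (fun ξ => hilbertSymbol ξ * poissonSymbol ε x ξ) =
      fun y => (-halfPlaneConjPoisson ε (x - y) : ℂ) := by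
  ext y
  rw [fourierInv_of_eq_mul_poissonSymbol hε x y (-Complex.I) Complex.I
    (fun ξ hξ => by simp [hilbertSymbol, hξ]) (fun ξ hξ => by simp [hilbertSymbol, hξ.not_gt])]
  rw [halfPlaneConjPoisson]
  push_cast
  rw [show -Complex.I * (ε - (x - y) * Complex.I) + Complex.I * (ε + (x - y) * Complex.I) =
      2 * (-(x - y) : ℂ) by linear_combination 2 * (x - y : ℂ) * Complex.I_sq,
    mul_assoc 2, mul_div_mul_left _ _ two_ne_zero, inv_mul_eq_div, div_div, mul_comm (Real.pi : ℂ),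
    neg_div]

/-- The conjugate Poisson integral of `w` is the Poisson integral of the multiplier Hilbert
transform of `w`. -/
lemma integral_halfPlaneConjPoisson_mul {ε : ℝ} (hε : 0 < ε) (x : ℝ)
    (w : Lp ℂ 2 (volume : Measure ℝ)) :
    ∫ y, (halfPlaneConjPoisson ε (x - y) : ℂ) * w y =
      ∫ y, (halfPlanePoisson ε (x - y) : ℂ) * hilbertL2 w y := by
  have hs := memLp_poissonSymbol hε x
  have hP : MemLp (𝓕⁻ (poissonSymbol ε x)) 2 := by
    rw [fourierInv_poissonSymbol hε]
    exact ((memLp_halfPlanePoisson hε).comp_measurePreserving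
      (Measure.measurePreserving_sub_left volume x)).ofReal
  have hQ : MemLp (𝓕⁻ fun ξ => hilbertSymbol ξ * poissonSymbol ε x ξ) 2 := by
    rw [fourierInv_hilbertSymbol_mul_poissonSymbol hε]
    exact ((memLp_halfPlaneConjPoisson hε).comp_measurePreserving
      (Measure.measurePreserving_sub_left volume x)).ofReal.neg
  have hi : Integrable fun ξ => hilbertSymbol ξ * poissonSymbol ε x ξ :=
    (integrable_poissonSymbol hε x).mono
      (measurable_hilbertSymbol.aestronglyMeasurable.mul hs.1)
      (.of_forall fun ξ => by rw [norm_mul, norm_hilbertSymbol, one_mul])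
  have key : ⟪hP.toLp _, hilbertL2 w⟫_ℂ = -⟪hQ.toLp _, w⟫_ℂ := by
    rw [← fourierInv_toLp_eq (integrable_poissonSymbol hε x) hs hP,
      ← fourierInv_toLp_eq hi hs.hilbertSymbol_mul hQ, inner_fourierInv_left,
      inner_fourierInv_left, hilbertL2, FourierTransform.fourier_fourierInv_eq]
    have h := inner_hilbertSymbol_mul hs (Lp.memLp (𝓕 w))
    rw [Lp.toLp_coeFn] at h
    rw [h, neg_neg]
  rw [L2.inner_def, L2.inner_def, ← integral_neg] at key
  calc _ = _ := integral_congr_ae ?_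
    _ = _ := key.symm
    _ = _ := integral_congr_ae ?_
  · filter_upwards [hQ.coeFn_toLp] with y hy
    rw [hy, fourierInv_hilbertSymbol_mul_poissonSymbol hε, RCLike.inner_apply]
    simp [mul_comm]
  · filter_upwards [hP.coeFn_toLp] with y hy
    rw [hy, fourierInv_poissonSymbol hε, RCLike.inner_apply]
    simp [mul_comm]

/-! ### Almost everywhere existence of the principal value -/

lemma measurableSet_lt_abs_sub (ε x : ℝ) : MeasurableSet {y : ℝ | ε < |x - y|} :=
  measurableSet_lt measurable_const (by fun_prop)

lemma indicator_div_eq_truncHilbertKernel_mul (u : ℝ → ℂ) (ε x : ℝ) :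
    {y : ℝ | ε < |x - y|}.indicator (fun y => u y / ((x - y : ℝ) : ℂ)) =
      fun y => (Real.pi : ℂ) * ((truncHilbertKernel ε (x - y) : ℂ) * u y) := by
  have hpi : (Real.pi : ℂ) ≠ 0 := by exact_mod_cast Real.pi_ne_zero
  ext y
  by_cases h : ε < |x - y|
  · rw [Set.indicator_of_mem (by exact h), truncHilbertKernel, if_pos h]
    push_cast
    field_simp
  · rw [Set.indicator_of_notMem (by exact h), truncHilbertKernel, if_neg h]
    simp

lemma integrable_truncHilbertKernel_mul {u : ℝ → ℂ} (hu : MemLp u 2) {ε : ℝ} (hε : 0 < ε)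
    (x : ℝ) : Integrable fun y => (truncHilbertKernel ε (x - y) : ℂ) * u y :=
  ((memLp_truncHilbertKernel hε).comp_measurePreserving
    (Measure.measurePreserving_sub_left volume x)).ofReal.integrable_mul hu

lemma integrableOn_div_sub {u : ℝ → ℂ} (hu : MemLp u 2) {ε : ℝ} (hε : 0 < ε) (x : ℝ) :
    IntegrableOn (fun y => u y / ((x - y : ℝ) : ℂ)) {y : ℝ | ε < |x - y|} := by
  rw [← integrable_indicator_iff (measurableSet_lt_abs_sub ε x),
    indicator_div_eq_truncHilbertKernel_mul]
  exact (integrable_truncHilbertKernel_mul hu hε x).const_mul _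

/-- At common Lebesgue points of `u` and of its multiplier Hilbert transform, the truncated
integrals converge: they differ from the conjugate Poisson integrals of `u`, that is, from the
Poisson integrals of the multiplier transform, by an averaging against kernels of mass `0`. -/
theorem ae_hasPrincipalValue_hilbertL2 {u : ℝ → ℂ} (hu : MemLp u 2) :
    ∀ᵐ x, HasPrincipalValue (fun y : ℝ => u y / ((x - y : ℝ) : ℂ)) x
      (Real.pi * hilbertL2 (hu.toLp u) x) := by
  have hF := Lp.memLp (hilbertL2 (hu.toLp u))
  filter_upwards [(hu.locallyIntegrable one_le_two).ae_isLebesguePoint,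
    (hF.locallyIntegrable one_le_two).ae_isLebesguePoint] with x hxu hxF
  refine ⟨fun ε hε => integrableOn_div_sub hu hε x, ?_⟩
  have hD := hxu.tendsto_integral_kernel_mul hu
    (K := fun ε t => halfPlaneConjPoisson ε t - truncHilbertKernel ε t) (c := 0)
    (fun ε => (measurable_halfPlaneConjPoisson ε).sub (measurable_truncHilbertKernel ε))
    (fun ε hε t => abs_halfPlaneConjPoisson_sub_truncHilbertKernel_le hε t)
    (fun ε _ => integral_halfPlaneConjPoisson_sub_truncHilbertKernel ε)
  have hP := hxF.tendsto_integral_kernel_mul hF (K := halfPlanePoisson) (c := 1)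
    measurable_halfPlanePoisson
    (fun ε hε t => (abs_of_nonneg (halfPlanePoisson_nonneg hε t)).le)
    (fun ε hε => integral_halfPlanePoisson hε)
  have h := (hP.sub hD).const_mul (Real.pi : ℂ)
  simp only [Complex.ofReal_one, one_mul, Complex.ofReal_zero, zero_mul, sub_zero] at h
  refine h.congr' ?_
  filter_upwards [self_mem_nhdsWithin] with ε (hε : 0 < ε)
  have iT := integrable_truncHilbertKernel_mul hu hε x
  have iQ : Integrable fun y => (halfPlaneConjPoisson ε (x - y) : ℂ) * u y :=
    ((memLp_halfPlaneConjPoisson hε).comp_measurePreserving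
      (Measure.measurePreserving_sub_left volume x)).ofReal.integrable_mul hu
  have hQ : ∫ y, (halfPlaneConjPoisson ε (x - y) : ℂ) * (hu.toLp u) y =
      ∫ y, (halfPlaneConjPoisson ε (x - y) : ℂ) * u y := by
    refine integral_congr_ae ?_
    filter_upwards [hu.coeFn_toLp] with y hy
    rw [hy]
  rw [← integral_indicator (measurableSet_lt_abs_sub ε x),
    indicator_div_eq_truncHilbertKernel_mul, integral_const_mul,
    ← integral_halfPlaneConjPoisson_mul hε, hQ]
  simp_rw [Complex.ofReal_sub, sub_mul]
  rw [integral_sub iQ iT, sub_sub_cancel]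

/-- The pointwise Hilbert transform is almost everywhere the multiplier Hilbert transform. -/
theorem hilbertTransform_ae_eq {u : ℝ → ℂ} (hu : MemLp u 2) :
    hilbertTransform u =ᵐ[volume] hilbertL2 (hu.toLp u) := by
  have hpi : (Real.pi : ℂ) ≠ 0 := by exact_mod_cast Real.pi_ne_zero
  filter_upwards [ae_hasPrincipalValue_hilbertL2 hu] with x hx
  rw [hilbertTransform, hx.principalValue_eq]
  field_simp

theorem memLp_hilbertTransform {u : ℝ → ℂ} (hu : MemLp u 2) : MemLp (hilbertTransform u) 2 :=
  (Lp.memLp (hilbertL2 (hu.toLp u))).ae_eq (hilbertTransform_ae_eq hu).symm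

lemma HasPrincipalValue.conj {f : ℝ → ℂ} {x : ℝ} {I : ℂ} (h : HasPrincipalValue f x I) :
    HasPrincipalValue (fun y => conj (f y)) x (conj I) := by
  refine ⟨fun ε hε => ?_, ?_⟩
  · exact (integrable_norm_iff (Complex.continuous_conj.comp_aestronglyMeasurable (h.1 ε hε).1)).1
      (by simpa using (h.1 ε hε).norm)
  · refine ((Complex.continuous_conj.tendsto I).comp h.2).congr fun ε => ?_
    exact integral_conj.symm

/-- The Hilbert transform is skew-symmetric for the bilinear pairing. This follows from
skew-adjointness because the pointwise Hilbert transform, having a real kernel, commutes with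
complex conjugation. -/
theorem integral_hilbertTransform_mul {u v : ℝ → ℂ} (hu : MemLp u 2) (hv : MemLp v 2) :
    ∫ x, hilbertTransform u x * v x = -∫ x, u x * hilbertTransform v x := by
  have hv' : MemLp (fun x => conj (v x)) 2 := hv.star
  have hconj : ∀ᵐ x, hilbertL2 (hv'.toLp _) x = conj (hilbertTransform v x) := by
    filter_upwards [ae_hasPrincipalValue_hilbertL2 hv, hilbertTransform_ae_eq hv'] with x h1 h2
    have h3 := h1.conj
    simp only [map_div₀, Complex.conj_ofReal] at h3
    rw [← h2, hilbertTransform, hilbertTransform, h1.principalValue_eq, h3.principalValue_eq]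
    simp
  have e1 : ⟪hilbertL2 (hv'.toLp _), hu.toLp u⟫_ℂ = ∫ x, u x * hilbertTransform v x := by
    rw [L2.inner_def]
    refine integral_congr_ae ?_
    filter_upwards [hconj, hu.coeFn_toLp] with x h1 h2
    rw [h1, h2, RCLike.inner_apply, Complex.conj_conj]
  have e2 : ⟪hv'.toLp _, hilbertL2 (hu.toLp u)⟫_ℂ = ∫ x, hilbertTransform u x * v x := by
    rw [L2.inner_def]
    refine integral_congr_ae ?_
    filter_upwards [hv'.coeFn_toLp, hilbertTransform_ae_eq hu] with x h1 h2
    rw [h1, ← h2, RCLike.inner_apply, Complex.conj_conj]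
  have h := inner_hilbertL2_left (hv'.toLp _) (hu.toLp u)
  rw [e1, e2] at h
  rw [h, neg_neg]

/-! ### The half Laplacian of a Schwartz function -/

lemma fracLaplacianConst_half : fracLaplacianConst (1 / 2) = 1 / Real.pi := by
  have h : Real.Gamma (-(1 / 2)) = -(2 * Real.sqrt Real.pi) := by
    have := Real.Gamma_add_one (s := -(1 / 2)) (by norm_num)
    rw [show (-(1 / 2) + 1 : ℝ) = 1 / 2 by norm_num, Real.Gamma_one_half_eq] at this
    linarith
  have h4 : (4 : ℝ) ^ (1 / 2 : ℝ) = 2 := by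
    rw [← Real.sqrt_eq_rpow, show (4 : ℝ) = 2 ^ 2 by norm_num, Real.sqrt_sq (by norm_num)]
  have hs : 0 < Real.sqrt Real.pi := Real.sqrt_pos.2 Real.pi_pos
  rw [fracLaplacianConst, h, h4, abs_neg, abs_of_pos (by positivity), ← Real.sqrt_eq_rpow,
    show (1 / 2 + 1 / 2 : ℝ) = 1 by norm_num, Real.Gamma_one]
  have : Real.sqrt Real.pi * (2 * Real.sqrt Real.pi) = 2 * Real.pi := by
    rw [mul_left_comm, Real.mul_self_sqrt Real.pi_pos.le]
  rw [this, mul_one]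
  field_simp

lemma integrableOn_inv_sub_sq {ε : ℝ} (hε : 0 < ε) (x : ℝ) :
    IntegrableOn (fun y : ℝ => ((x - y) ^ 2)⁻¹) {y : ℝ | ε < |x - y|} := by
  refine Integrable.mono' (((integrable_halfPlanePoisson hε).comp_sub_left x).const_mul
    (2 * Real.pi / ε)).integrableOn (by fun_prop) ?_
  refine (ae_restrict_iff' (measurableSet_lt_abs_sub ε x)).2 (.of_forall fun y hy => ?_)
  have hpi := Real.pi_pos
  have hy' : ε ^ 2 ≤ (x - y) ^ 2 := by
    rw [← sq_abs (x - y)]; have : ε < |x - y| := hy; gcongr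
  have h0 : 0 < (x - y) ^ 2 := lt_of_lt_of_le (by positivity) hy'
  rw [Real.norm_of_nonneg (by positivity), halfPlanePoisson]
  have e : 2 * Real.pi / ε * (Real.pi⁻¹ * (ε / (ε ^ 2 + (x - y) ^ 2))) =
      2 / (ε ^ 2 + (x - y) ^ 2) := by field_simp
  rw [e, inv_eq_one_div, div_le_div_iff₀ h0 (by positivity)]
  linarith

lemma integrableOn_sub_div_sq (φ : 𝓢(ℝ, ℂ)) {ε : ℝ} (hε : 0 < ε) (x : ℝ) :
    IntegrableOn (fun y => (φ x - φ y) / ((x - y : ℝ) : ℂ) ^ 2) {y : ℝ | ε < |x - y|} := by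
  obtain ⟨C, hC⟩ := φ.decay 0 0
  have hb : ∀ y, ‖φ y‖ ≤ C := fun y => by simpa using hC.2 y
  refine Integrable.mono' ((integrableOn_inv_sub_sq hε x).const_mul (C + C))
    (Measurable.aestronglyMeasurable ?_) (.of_forall fun y => ?_)
  · have := φ.continuous.measurable
    fun_prop
  · rw [norm_div, norm_pow, Complex.norm_real, Real.norm_eq_abs, sq_abs, div_eq_mul_inv]
    gcongr
    exact (norm_sub_le _ _).trans (add_le_add (hb x) (hb y))

/-- Integration by parts off `[x - ε, x + ε]`: with `h y = (φ x - φ y) / (x - y)`, the two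
integrands differ by `h'`, and `h` vanishes at infinity. -/
lemma setIntegral_sub_div_sq_eq (φ : 𝓢(ℝ, ℂ)) {ε : ℝ} (hε : 0 < ε) (x : ℝ) :
    ∫ y in {y : ℝ | ε < |x - y|}, (φ x - φ y) / ((x - y : ℝ) : ℂ) ^ 2 =
      (∫ y in {y : ℝ | ε < |x - y|}, derivCLM ℂ ℂ φ y / ((x - y : ℝ) : ℂ)) +
        ((φ x - φ (x - ε)) / ((x - (x - ε) : ℝ) : ℂ) -
          (φ x - φ (x + ε)) / ((x - (x + ε) : ℝ) : ℂ)) := by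
  have i1 := integrableOn_sub_div_sq φ hε x
  have i2 := integrableOn_div_sub ((derivCLM ℂ ℂ φ).memLp 2) hε x
  have hset : {y : ℝ | ε < |x - y|} = Set.Iio (x - ε) ∪ Set.Ioi (x + ε) := by
    ext y
    simp only [Set.mem_ofPred_eq, Set.mem_union, Set.mem_Iio, Set.mem_Ioi, lt_abs]
    constructor <;> (rintro (h | h)) <;> first | (left; linarith) | (right; linarith)
  set h : ℝ → ℂ := fun y => (φ x - φ y) / ((x - y : ℝ) : ℂ) with hh
  set h' : ℝ → ℂ := fun y => (φ x - φ y) / ((x - y : ℝ) : ℂ) ^ 2 -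
    derivCLM ℂ ℂ φ y / ((x - y : ℝ) : ℂ) with hh'
  have i3 : IntegrableOn h' (Set.Iio (x - ε) ∪ Set.Ioi (x + ε)) := hset ▸ i1.sub i2
  have hd : ∀ y, y ≠ x → HasDerivAt h (h' y) y := by
    intro y hy
    have hxy : ((x - y : ℝ) : ℂ) ≠ 0 := by exact_mod_cast sub_ne_zero.2 hy.symm
    have d1 : HasDerivAt (fun y => φ x - φ y) (-derivCLM ℂ ℂ φ y) y := by
      rw [derivCLM_apply]
      exact (φ.differentiableAt.hasDerivAt).const_sub _
    have d2 : HasDerivAt (fun y : ℝ => ((x - y : ℝ) : ℂ)) ((-1 : ℝ) : ℂ) y :=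
      ((hasDerivAt_id y).const_sub x).ofReal_comp
    convert! d1.div d2 hxy using 1
    rw [hh']
    push_cast at hxy ⊢
    field_simp
    ring
  have hlim : Tendsto h (cocompact ℝ) (𝓝 0) := by
    have t1 : Tendsto (fun y => φ x - φ y) (cocompact ℝ) (𝓝 (φ x - 0)) :=
      tendsto_const_nhds.sub φ.tendsto_cocompact
    have t2 : Tendsto (fun y : ℝ => ((x - y : ℝ) : ℂ)⁻¹) (cocompact ℝ) (𝓝 0) := by
      rw [tendsto_zero_iff_norm_tendsto_zero]
      have : Tendsto (fun y : ℝ => ‖x - y‖) (cocompact ℝ) atTop :=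
        (tendsto_norm_cocompact_atTop (E := ℝ)).comp
          (Homeomorph.subLeft x).isClosedEmbedding.tendsto_cocompact
      refine this.inv_tendsto_atTop.congr fun y => ?_
      rw [Pi.inv_apply, norm_inv, Complex.norm_real]
    simpa [hh, div_eq_mul_inv] using t1.mul t2
  have hI : ∫ y in {y : ℝ | ε < |x - y|}, h' y = h (x - ε) - h (x + ε) := by
    rw [hset, setIntegral_union (Set.disjoint_left.2 fun y h1 h2 => by
        have h1 : y < x - ε := h1
        have h2 : x + ε < y := h2
        linarith) measurableSet_Ioi (i3.mono_set Set.subset_union_left)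
        (i3.mono_set Set.subset_union_right), ← integral_Iic_eq_integral_Iio,
      integral_Iic_of_hasDerivAt_of_tendsto' (f := h) (m := 0) (fun y hy => hd y ?_)
        ((integrableOn_Iic_iff_integrableOn_Iio).2 (i3.mono_set Set.subset_union_left))
        (hlim.mono_left atBot_le_cocompact),
      integral_Ioi_of_hasDerivAt_of_tendsto' (f := h) (m := 0) (fun y hy => hd y ?_)
        (i3.mono_set Set.subset_union_right) (hlim.mono_left atTop_le_cocompact)]
    · ring
    · have : x + ε ≤ y := hy
      intro h; linarith
    · have : y ≤ x - ε := hy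
      intro h; linarith
  rw [hh', integral_sub i1 i2] at hI
  rw [← hI]
  ring

/-- The two boundary terms of the integration by parts are difference quotients of `φ` at `x`,
hence cancel in the limit. -/
lemma tendsto_boundary_term (φ : 𝓢(ℝ, ℂ)) (x : ℝ) :
    Tendsto (fun ε : ℝ => (φ x - φ (x - ε)) / ((x - (x - ε) : ℝ) : ℂ) -
      (φ x - φ (x + ε)) / ((x - (x + ε) : ℝ) : ℂ)) (𝓝[>] 0) (𝓝 0) := by
  have hd := hasDerivAt_iff_tendsto_slope_zero.1 (φ.differentiableAt (x := x)).hasDerivAt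
  have hp : Tendsto (fun ε : ℝ => ε) (𝓝[>] 0) (𝓝[≠] 0) :=
    tendsto_id.mono_left (nhdsWithin_mono _ fun _ h => ne_of_gt h)
  have hn : Tendsto (fun ε : ℝ => -ε) (𝓝[>] 0) (𝓝[≠] 0) := by
    refine tendsto_nhdsWithin_iff.2 ⟨?_, ?_⟩
    · exact (Continuous.tendsto' (by fun_prop) 0 0 (by simp)).mono_left nhdsWithin_le_nhds
    · filter_upwards [self_mem_nhdsWithin] with ε (hε : 0 < ε)
      simpa using hε.ne'
  have h := (hd.comp hn).sub (hd.comp hp)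
  rw [sub_self] at h
  refine h.congr fun ε => ?_
  simp only [Function.comp_apply, Complex.real_smul]
  push_cast
  rw [← sub_eq_add_neg]
  simp only [sub_sub_cancel, sub_add_cancel_left, div_eq_mul_inv, inv_neg]
  ring

/-- For Schwartz functions, `(-Δ)^{1/2} φ` is the Hilbert transform of `φ'`. -/
theorem fracLaplacian_half_ae_eq (φ : 𝓢(ℝ, ℂ)) :
    fracLaplacian (1 / 2) φ =ᵐ[volume] hilbertTransform (derivCLM ℂ ℂ φ) := by
  filter_upwards [ae_hasPrincipalValue_hilbertL2 ((derivCLM ℂ ℂ φ).memLp 2)] with x hx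
  have hsq : (fun y : ℝ => (φ x - φ y) / ((|x - y| ^ (1 + 2 * (1 / 2) : ℝ) : ℝ) : ℂ)) =
      fun y => (φ x - φ y) / ((x - y : ℝ) : ℂ) ^ 2 := by
    ext y
    rw [show (1 + 2 * (1 / 2) : ℝ) = (2 : ℕ) by norm_num, Real.rpow_natCast, sq_abs]
    push_cast
    rfl
  have hpv : HasPrincipalValue (fun y => (φ x - φ y) / ((x - y : ℝ) : ℂ) ^ 2) x
      (Real.pi * hilbertL2 (((derivCLM ℂ ℂ φ).memLp 2).toLp _) x) := by
    refine ⟨fun ε hε => integrableOn_sub_div_sq φ hε x, ?_⟩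
    have h := hx.2.add (tendsto_boundary_term φ x)
    rw [add_zero] at h
    refine h.congr' ?_
    filter_upwards [self_mem_nhdsWithin] with ε (hε : 0 < ε)
    exact (setIntegral_sub_div_sq_eq φ hε x).symm
  rw [fracLaplacian, hsq, hpv.principalValue_eq, hilbertTransform, hx.principalValue_eq,
    fracLaplacianConst_half]
  push_cast
  rfl

end

theorem mainTheorem2 (u : ℝ → ℂ) (hu : MemLp u 2 (volume : Measure ℝ))
    (T : 𝓢'(ℝ, ℂ)) (hT : ∀ φ : 𝓢(ℝ, ℂ), T φ = sqrtLaplacian u φ) :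
    (∀ᵐ x : ℝ, ∃ I : ℂ, HasPrincipalValue (fun y : ℝ => u y / ((x - y : ℝ) : ℂ)) x I) ∧
    ∃ hH : MemLp (hilbertTransform u) 2 (volume : Measure ℝ),
      TemperedDistribution.derivCLM ℂ (Lp.toTemperedDistribution (hH.toLp (hilbertTransform u)))
        = T := by
  refine ⟨(ae_hasPrincipalValue_hilbertL2 hu).mono fun x hx => ⟨_, hx⟩,
    memLp_hilbertTransform hu, ?_⟩
  ext φ
  rw [TemperedDistribution.derivCLM_apply_apply, Lp.toTemperedDistribution_apply, hT,
    sqrtLaplacian]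
  calc ∫ x, (-derivCLM ℂ ℂ φ) x • ((memLp_hilbertTransform hu).toLp (hilbertTransform u)) x
      = -∫ x, hilbertTransform u x * derivCLM ℂ ℂ φ x := by
        rw [← integral_neg]
        refine integral_congr_ae ?_
        filter_upwards [(memLp_hilbertTransform hu).coeFn_toLp] with x hx
        rw [hx, _root_.neg_apply, smul_eq_mul]
        ring
    _ = ∫ x, u x * hilbertTransform (derivCLM ℂ ℂ φ) x := by
        rw [integral_hilbertTransform_mul hu ((derivCLM ℂ ℂ φ).memLp 2), neg_neg]
    _ = ∫ x, u x * fracLaplacian (1 / 2) φ x := by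
        refine integral_congr_ae ?_
        filter_upwards [fracLaplacian_half_ae_eq φ] with x hx
        rw [hx]
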